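/- Let $[X_{n,i}:1\le i\le n,\ n\ge1]$ be a triangular array of $\mathbb R^d$-valued random variables ($d\ge1$) on a common probability space, all with the same marginal law $\mu$, and for $m\ge1$ let \[ \alpha_m=\sup_{n\ge1}\ \sup_{1\le k\le n-m}\ \sup\big\{|\mathrm P(A\cap B)-\mathrm P(A)\mathrm P(B)|:\ A\in\sigma(X_{n,i}:1\le i\le k),\ B\in\sigma(X_{n,i}:k+m\le i\le n)\big\} \] be its strong mixing coefficients. For $x\in\mathbb R^d$ and $1\le k\le n$ let $R_{n,k}(x)$ be the Euclidean distance from $x$ to its $k$-th nearest neighbor among $X_{n,1},\dots,X_{n,n}$. For every $\gamma>0$ there are constants $c_0>0$, $C>0$ and $N\ge 0$, depending only on $\gamma$, such that the following holds. Suppose that (i) (geometric $\alpha$-mixing) $\alpha_m\le e^{-\gamma m}$ for all $m\ge1$; (ii) (local lower mass of order $s$ at $x$) there are $c_->0$, $r_0>0$ and $s>0$ with $\mu(B(x,r))\ge c_-r^s$ for all $0<r\le r_0$, where $B(x,r)$ is the closed Euclidean ball; (iii) (compact support) the support of $\mu$ is contained in a compact set of diameter at most $D$. Put $r_*(n,k)=\big(8k/(c_-n)\big)^{1/s}$.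 Then for all $n\ge N$, all $1\le k\le n$ and every integer $j\ge0$ with $2^jr_*(n,k)\le r_0$, \[ \mathrm P\big(R_{n,k}(x)>2^jr_*(n,k)\big)\ \le\ 4\exp\Big(-c_0\,2^{js}\,\frac{k}{\log n}\Big)+C\,n^{-7}. \] -/

import Mathlib

open MeasureTheory

namespace KNN

/-- The rows of a triangular array `X` are indexed by `n ≥ 1` and the entries of row `n` by
`1 ≤ i ≤ n`; values of `X` at other indices are never used.
The array consists of random vectors of `ℝ^d` with common marginal law `μ`. -/
structure IsTriangularArray {Ω : Type*} [MeasurableSpace Ω] {d : ℕ} (P : Measure Ω)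
    (X : ℕ → ℕ → Ω → EuclideanSpace ℝ (Fin d))
    (μ : Measure (EuclideanSpace ℝ (Fin d))) : Prop where
  measurable : ∀ n i : ℕ, 1 ≤ i → i ≤ n → Measurable (X n i)
  map_eq : ∀ n i : ℕ, 1 ≤ i → i ≤ n → P.map (X n i) = μ

/-- The σ-field generated by `X n i`, `a ≤ i ≤ b`. -/
abbrev segmentSigma {Ω : Type*} {d : ℕ} (X : ℕ → ℕ → Ω → EuclideanSpace ℝ (Fin d))
    (n a b : ℕ) : MeasurableSpace Ω :=
  ⨆ i ∈ Set.Icc a b, MeasurableSpace.comap (X n i) inferInstance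

/-- The strong mixing coefficient `α_m` of a triangular array: the supremum, over all rows `n`, all
`1 ≤ k ≤ n - m` and all events `A` of the first `k` entries and `B` of the entries from `k + m` on,
of `|P(A ∩ B) - P(A) P(B)|`. (The set of these numbers is bounded by `1`.) -/
noncomputable def alphaCoeff {Ω : Type*} [MeasurableSpace Ω] {d : ℕ} (P : Measure Ω)
    (X : ℕ → ℕ → Ω → EuclideanSpace ℝ (Fin d)) (m : ℕ) : ℝ :=
  sSup {t : ℝ | ∃ (n k : ℕ) (A B : Set Ω), 1 ≤ k ∧ k + m ≤ n ∧
    MeasurableSet[segmentSigma X n 1 k] A ∧ MeasurableSet[segmentSigma X n (k + m) n] B ∧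
    t = |P.real (A ∩ B) - P.real A * P.real B|}

/-- Geometric `α`-mixing with rate `γ`. -/
def GeometricMixing {Ω : Type*} [MeasurableSpace Ω] {d : ℕ} (P : Measure Ω)
    (X : ℕ → ℕ → Ω → EuclideanSpace ℝ (Fin d)) (γ : ℝ) : Prop :=
  ∀ m : ℕ, 1 ≤ m → alphaCoeff P X m ≤ Real.exp (-γ * m)

/-- Local lower mass of order `s` at `x`: `μ(B(x, r)) ≥ c r ^ s` for `0 < r ≤ r₀`, where `B(x, r)` is
the closed Euclidean ball. -/
def LocalLowerMass {d : ℕ} (μ : Measure (EuclideanSpace ℝ (Fin d)))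
    (x : EuclideanSpace ℝ (Fin d)) (c r₀ s : ℝ) : Prop :=
  ∀ r : ℝ, 0 < r → r ≤ r₀ → c * r ^ s ≤ μ.real (Metric.closedBall x r)

/-- The support of `μ` is contained in a compact set of diameter at most `D`. -/
def SupportInCompact {d : ℕ} (μ : Measure (EuclideanSpace ℝ (Fin d))) (D : ℝ) : Prop :=
  ∃ K : Set (EuclideanSpace ℝ (Fin d)), IsCompact K ∧ μ.support ⊆ K ∧ Metric.diam K ≤ D

/-- An ordering of the `n`-th row by increasing distance to `x`
(position `i : Fin n` stands for the entry `X n (i + 1)`; ties are broken by the index, and the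
distances do not depend on how they are broken). -/
noncomputable def distanceOrder {Ω : Type*} {d : ℕ} (X : ℕ → ℕ → Ω → EuclideanSpace ℝ (Fin d))
    (x : EuclideanSpace ℝ (Fin d)) (n : ℕ) (ω : Ω) : Equiv.Perm (Fin n) :=
  Tuple.sort fun i : Fin n => ‖X n ((i : ℕ) + 1) ω - x‖

/-- The `k`-th nearest neighbor of `x` among `X n 1, …, X n n`, for `1 ≤ k ≤ n`. -/
noncomputable def nearestNeighbor {Ω : Type*} {d : ℕ} (X : ℕ → ℕ → Ω → EuclideanSpace ℝ (Fin d))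
    (x : EuclideanSpace ℝ (Fin d)) (n k : ℕ) (hk : 1 ≤ k ∧ k ≤ n) (ω : Ω) :
    EuclideanSpace ℝ (Fin d) :=
  X n ((distanceOrder X x n ω ⟨k - 1, by omega⟩ : ℕ) + 1) ω

/-- The `k`-nearest-neighbor radius `R_{n,k}(x)`. -/
noncomputable def nnRadius {Ω : Type*} {d : ℕ} (X : ℕ → ℕ → Ω → EuclideanSpace ℝ (Fin d))
    (x : EuclideanSpace ℝ (Fin d)) (n k : ℕ) (hk : 1 ≤ k ∧ k ≤ n) (ω : Ω) : ℝ :=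
  ‖nearestNeighbor X x n k hk ω - x‖

/-- The radius `r_*(n, k) = (8 k / (c n)) ^ (1 / s)`. -/
noncomputable def rStar (c s : ℝ) (n k : ℕ) : ℝ :=
  (8 * (k : ℝ) / (c * (n : ℝ))) ^ (1 / s)

end KNN

/-! If the `k`-th neighbor radius exceeds `r`, the ball `B(x, r)` holds fewer than `k` entries of
the row, whereas lower mass makes the mean count at least `8 * k * 2 ^ (j * s)`. So a Chernoff
lower-tail bound for a dependent count is needed.

Indices are split into residue classes modulo `b ≈ (15 / γ) * log n`, whose entries are `b` apart.
Convexity of `exp` bounds the Laplace transform of the whole count at `lam / b` by the average over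
classes at `lam` (`exp_neg_sum_le_average`). In a class the transform factorizes up to one mixing
error per entry (`integral_prod_one_sub_indicator_le`). Since `exp (-γ * b) ≤ n ^ (-15)`, these
errors stay negligible provided the Chernoff factor is at most `n ^ 7`, which is what
`exists_exponent` arranges. -/

open Finset in
theorem sum_range_mul_eq_sum_residues (f : ℕ → ℝ) (b m : ℕ) :
    ∑ i ∈ range (b * m), f i = ∑ q ∈ range b, ∑ l ∈ range m, f (q + b * l) := by
  rw [sum_comm]
  induction m with
  | zero => simp
  | succ m ih =>
    rw [Nat.mul_succ, sum_range_add, ih, sum_range_succ]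
    simp only [add_comm]

/-! ### From radii to counts -/

theorem card_le_of_lt_nnRadius {Ω : Type*} {d : ℕ} (X : ℕ → ℕ → Ω → EuclideanSpace ℝ (Fin d))
    (x : EuclideanSpace ℝ (Fin d)) (n k : ℕ) (hk : 1 ≤ k ∧ k ≤ n) (ω : Ω) (r : ℝ)
    (h : r < KNN.nnRadius X x n k hk ω) :
    ∑ i ∈ Finset.range n,
      (X n (i + 1) ⁻¹' Metric.closedBall x r).indicator (fun _ => (1 : ℝ)) ω ≤ k := by
  classical
  set f : Fin n → ℝ := fun i => ‖X n ((i : ℕ) + 1) ω - x‖ with hf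
  set σ := Tuple.sort f with hσ
  have hr : r < f (σ ⟨k - 1, by omega⟩) := h
  have hmono : Monotone (f ∘ σ) := Tuple.monotone_sort f
  -- The zero-based position `k - 1` of the sorted distances already exceeds `r`, so only earlier
  -- positions can be within `r`.
  have hcard : (Finset.univ.filter fun j : Fin n => (f ∘ σ) j ≤ r).card ≤ k - 1 := by
    have := (Tuple.lt_card_le_iff_apply_le_of_monotone (j := ⟨k - 1, by omega⟩) (a := r) hmono).not.2
      (not_le.2 hr)
    simpa using this
  have hsum : ∑ i ∈ Finset.range n,
      (X n (i + 1) ⁻¹' Metric.closedBall x r).indicator (fun _ => (1 : ℝ)) ω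
      = ∑ i : Fin n, if f i ≤ r then (1 : ℝ) else 0 := by
    rw [Finset.sum_range]
    refine Finset.sum_congr rfl fun i _ => ?_
    simp [Set.indicator_apply, hf, Metric.mem_closedBall, dist_eq_norm]
  rw [hsum, ← Equiv.sum_comp σ, Finset.sum_boole]
  exact_mod_cast hcard.trans (Nat.sub_le k 1)

/-! ### Decoupling -/

/-- By the layer-cake formula the covariance deficit is the average over `t ∈ (0, 1]` of the
deficits of the events `{t ≤ U}`, so passing from events to `[0, 1]`-valued functions costs no
constant. -/
theorem integral_mul_measureReal_sub_le {Ω : Type*} {m : MeasurableSpace Ω}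
    [m₀ : MeasurableSpace Ω] (P : Measure Ω) [IsProbabilityMeasure P] (hm : m ≤ m₀) {U : Ω → ℝ}
    (hU : Measurable[m] U) (hU0 : ∀ ω, 0 ≤ U ω) (hU1 : ∀ ω, U ω ≤ 1) {A : Set Ω}
    {α : ℝ} (hα : ∀ H, MeasurableSet[m] H → P.real H * P.real A - P.real (H ∩ A) ≤ α) :
    (∫ ω, U ω ∂P) * P.real A - ∫ ω in A, U ω ∂P ≤ α := by
  have hUm : Measurable U := hU.mono hm le_rfl
  have layer : ∀ Q : Measure Ω, IsFiniteMeasure Q →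
      ∫ ω, U ω ∂Q = ∫ t in Set.Ioc 0 1, Q.real {a | t ≤ U a} := by
    intro Q _
    refine Integrable.integral_eq_integral_Ioc_meas_le ?_ (.of_forall hU0) (.of_forall hU1)
    exact .of_bound hUm.aestronglyMeasurable 1
      (.of_forall fun ω => by rw [Real.norm_eq_abs, abs_of_nonneg (hU0 ω)]; exact hU1 ω)
  have hint : ∀ Q : Measure Ω, IsFiniteMeasure Q →
      IntegrableOn (fun t => Q.real {a | t ≤ U a}) (Set.Ioc 0 1) := by
    intro Q _
    have hanti : Antitone fun t : ℝ => Q.real {a | t ≤ U a} :=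
      fun s t hst => measureReal_mono fun a (ha : t ≤ U a) => hst.trans ha
    exact .of_bound (by simp) hanti.measurable.aestronglyMeasurable (Q.real Set.univ)
      (.of_forall fun t => by
        rw [Real.norm_eq_abs, abs_of_nonneg measureReal_nonneg]
        exact measureReal_mono (Set.subset_univ _))
  rw [layer P inferInstance, layer (P.restrict A) inferInstance, ← integral_mul_const,
    ← integral_sub ((hint P inferInstance).mul_const _) (hint (P.restrict A) inferInstance)]
  have : ∫ _ in Set.Ioc (0 : ℝ) 1, α = α := by simp
  rw [← this]
  refine integral_mono (((hint P inferInstance).mul_const _).sub (hint (P.restrict A) inferInstance))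
    (by simp) fun t => ?_
  have hH : MeasurableSet[m] {a | t ≤ U a} := measurableSet_le measurable_const hU
  simp only
  rw [measureReal_restrict_apply (hm _ hH)]
  exact hα _ hH

/-- If each event is nearly independent of its predecessors, then the Laplace transform of the number
of events that occur is nearly the product of the individual ones. -/
theorem integral_prod_one_sub_indicator_le {Ω : Type*} [m₀ : MeasurableSpace Ω] (P : Measure Ω)
    [IsProbabilityMeasure P] (m : ℕ → MeasurableSpace Ω) (hm : ∀ l, m l ≤ m₀) (A : ℕ → Set Ω)
    {M : ℕ} {p α θ : ℝ} (hθ0 : 0 ≤ θ) (hθ1 : θ ≤ 1) (hα0 : 0 ≤ α)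
    (hA : ∀ l < M, ∀ i < l, MeasurableSet[m l] (A i)) (hA' : ∀ l < M, MeasurableSet (A l))
    (hp : ∀ l < M, P.real (A l) = p)
    (hα : ∀ l < M, 1 ≤ l → ∀ H, MeasurableSet[m l] H →
      P.real H * P.real (A l) - P.real (H ∩ A l) ≤ α) :
    ∀ l ≤ M, ∫ ω, ∏ i ∈ Finset.range l, (1 - θ * (A i).indicator (fun _ => (1 : ℝ)) ω) ∂P
      ≤ (1 - θ * p) ^ l + l * α := by
  have hI : ∀ i ω, 0 ≤ (A i).indicator (fun _ => (1 : ℝ)) ω ∧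
      (A i).indicator (fun _ => (1 : ℝ)) ω ≤ 1 := fun i ω => by
    by_cases h : ω ∈ A i <;> simp [h]
  have hY0 : ∀ i ω, 0 ≤ 1 - θ * (A i).indicator (fun _ => (1 : ℝ)) ω := fun i ω => by
    nlinarith [hI i ω]
  have hY1 : ∀ i ω, 1 - θ * (A i).indicator (fun _ => (1 : ℝ)) ω ≤ 1 := fun i ω => by
    nlinarith [hI i ω, mul_nonneg hθ0 (hI i ω).1]
  intro l
  induction l with
  | zero => simp
  | succ l ih =>
    intro hl
    have hlM : l < M := hl
    set U : Ω → ℝ := fun ω =>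
      ∏ i ∈ Finset.range l, (1 - θ * (A i).indicator (fun _ => (1 : ℝ)) ω) with hUdef
    have hU : Measurable[m l] U := by
      refine Finset.measurable_fun_prod _ fun i hi => ?_
      exact ((@measurable_const _ _ _ (m l) _).indicator
        (hA l hlM i (Finset.mem_range.1 hi))).const_mul θ |>.const_sub 1
    have hU0 : ∀ ω, 0 ≤ U ω := fun ω => Finset.prod_nonneg fun i _ => hY0 i ω
    have hU1 : ∀ ω, U ω ≤ 1 := fun ω => Finset.prod_le_one (fun i _ => hY0 i ω) fun i _ => hY1 i ω
    have hUi : Integrable U P := .of_bound (hU.mono (hm l) le_rfl).aestronglyMeasurable 1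
      (.of_forall fun ω => by rw [Real.norm_eq_abs, abs_of_nonneg (hU0 ω)]; exact hU1 ω)
    have hcov : (∫ ω, U ω ∂P) * p - ∫ ω in A l, U ω ∂P ≤ α := by
      rw [← hp l hlM]
      rcases Nat.eq_zero_or_pos l with rfl | hl1
      · simpa [hUdef] using hα0
      · exact integral_mul_measureReal_sub_le P (hm l) hU hU0 hU1 (hα l hlM hl1)
    have hstep : ∫ ω, ∏ i ∈ Finset.range (l + 1),
        (1 - θ * (A i).indicator (fun _ => (1 : ℝ)) ω) ∂P
        = (∫ ω, U ω ∂P) - θ * ∫ ω in A l, U ω ∂P := by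
      rw [← integral_indicator (hA' l hlM), ← integral_const_mul,
        ← integral_sub hUi ((hUi.indicator (hA' l hlM)).const_mul θ)]
      refine integral_congr_ae (.of_forall fun ω => ?_)
      simp only [Finset.prod_range_succ, hUdef]
      by_cases h : ω ∈ A l <;> simp [h]
      ring
    rw [hstep]
    have hp01 : 0 ≤ p ∧ p ≤ 1 := by
      rw [← hp l hlM]; exact ⟨measureReal_nonneg, measureReal_le_one⟩
    have h1 : 0 ≤ θ * p := mul_nonneg hθ0 hp01.1
    have h2 : θ * p ≤ 1 := mul_le_one₀ hθ1 hp01.1 hp01.2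
    -- One step of the recursion `a (l + 1) ≤ (1 - θ * p) * a l + θ * α`.
    have ih' := mul_le_mul_of_nonneg_right (ih hlM.le) (sub_nonneg.2 h2)
    have h3 := mul_le_mul_of_nonneg_left hcov hθ0
    have h4 : θ * α ≤ α := mul_le_of_le_one_left hα0 hθ1
    have h5 : 0 ≤ θ * p * (l * α) := by positivity
    rw [pow_succ]
    push_cast
    nlinarith

/-! ### Lower tails for counts -/

/-- Jensen's inequality for the exponential of a sum that is split into `b` groups. -/
theorem exp_neg_sum_le_average {b : ℕ} (hb : 1 ≤ b) (lam : ℝ) (S : ℕ → ℝ) :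
    Real.exp (-(lam / b) * ∑ q ∈ Finset.range b, S q)
      ≤ (∑ q ∈ Finset.range b, Real.exp (-lam * S q)) / b := by
  have hb' : (0 : ℝ) < b := by exact_mod_cast hb
  have := convexOn_exp.map_sum_le (t := Finset.range b) (w := fun _ => (1 / b : ℝ))
    (p := fun q => -lam * S q) (fun _ _ => by positivity)
    (by simp [hb'.ne']) (fun _ _ => Set.mem_univ _)
  simp only [smul_eq_mul, ← Finset.mul_sum] at this
  rw [div_eq_mul_one_div (∑ q ∈ Finset.range b, _), mul_comm _ (1 / (b : ℝ)),
    show -(lam / b) * ∑ q ∈ Finset.range b, S q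
      = 1 / b * (-lam * ∑ q ∈ Finset.range b, S q) by ring]
  exact this

theorem half_le_one_sub_exp_neg {lam : ℝ} (h0 : 0 ≤ lam) (h1 : lam ≤ 1) :
    lam / 2 ≤ 1 - Real.exp (-lam) := by
  have h := Real.add_one_le_exp lam
  have hmul : Real.exp lam * Real.exp (-lam) = 1 := by rw [← Real.exp_add]; simp
  have hpos := Real.exp_pos (-lam)
  nlinarith

/-- A lower-tail bound for the number of occurrences among stationary events for which events
at distance `b` in each residue class are nearly independent. -/
theorem measureReal_count_le {Ω : Type*} [m₀ : MeasurableSpace Ω] (P : Measure Ω)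
    [IsProbabilityMeasure P] (A : ℕ → Set Ω) (n b M : ℕ) (hb : 1 ≤ b) (hbM : b * M ≤ n)
    (m : ℕ → ℕ → MeasurableSpace Ω) (hm : ∀ q < b, ∀ l, m q l ≤ m₀)
    {p α lam κ : ℝ} (hα0 : 0 ≤ α) (hl0 : 0 ≤ lam) (hl1 : lam ≤ 1)
    (hA : ∀ q < b, ∀ l < M, ∀ i < l, MeasurableSet[m q l] (A (q + b * i)))
    (hA' : ∀ i < n, MeasurableSet (A i)) (hp : ∀ i < n, P.real (A i) = p)
    (hp0 : 0 ≤ p)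
    (hα : ∀ q < b, ∀ l < M, 1 ≤ l → ∀ H, MeasurableSet[m q l] H →
      P.real H * P.real (A (q + b * l)) - P.real (H ∩ A (q + b * l)) ≤ α) :
    P.real {ω | ∑ i ∈ Finset.range n, (A i).indicator (fun _ => (1 : ℝ)) ω ≤ κ}
      ≤ Real.exp (lam * κ / b) * (Real.exp (-(lam / 2 * p * M)) + M * α) := by
  have hb' : (0 : ℝ) < b := by exact_mod_cast hb
  set θ : ℝ := 1 - Real.exp (-lam) with hθ
  have hθ2 : lam / 2 ≤ θ := half_le_one_sub_exp_neg hl0 hl1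
  have hθ0 : 0 ≤ θ := by linarith
  have hθ1 : θ ≤ 1 := by linarith [Real.exp_pos (-lam)]
  have hidx : ∀ q < b, ∀ l < M, q + b * l < n := fun q hq l hl => by
    have : b * (l + 1) ≤ b * M := Nat.mul_le_mul_left b hl
    rw [Nat.mul_succ] at this
    omega
  set G : ℕ → Ω → ℝ := fun q ω =>
    ∏ l ∈ Finset.range M, (1 - θ * (A (q + b * l)).indicator (fun _ => (1 : ℝ)) ω) with hG
  have hGexp : ∀ q ω, G q ω = Real.exp (-lam *
      ∑ l ∈ Finset.range M, (A (q + b * l)).indicator (fun _ => (1 : ℝ)) ω) := by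
    intro q ω
    rw [Finset.mul_sum, Real.exp_sum]
    refine Finset.prod_congr rfl fun l _ => ?_
    by_cases h : ω ∈ A (q + b * l) <;> simp [h, hθ]
  have hG0 : ∀ q ω, 0 ≤ G q ω := fun q ω => by rw [hGexp]; positivity
  have hG1 : ∀ q ω, G q ω ≤ 1 := fun q ω => by
    rw [hGexp, Real.exp_le_one_iff]
    have : 0 ≤ ∑ l ∈ Finset.range M, (A (q + b * l)).indicator (fun _ => (1 : ℝ)) ω :=
      Finset.sum_nonneg fun l _ => Set.indicator_nonneg (fun _ _ => zero_le_one) ω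
    nlinarith
  have hGi : ∀ q < b, Integrable (G q) P := fun q hq => by
    refine .of_bound (Measurable.aestronglyMeasurable ?_) 1
      (.of_forall fun ω => by rw [Real.norm_eq_abs, abs_of_nonneg (hG0 q ω)]; exact hG1 q ω)
    refine Finset.measurable_fun_prod _ fun l hl => ?_
    exact ((measurable_const.indicator
      (hA' _ (hidx q hq l (Finset.mem_range.1 hl)))).const_mul θ).const_sub 1
  have hGint : ∀ q < b, ∫ ω, G q ω ∂P ≤ Real.exp (-(lam / 2 * p * M)) + M * α := by
    intro q hq
    have h := integral_prod_one_sub_indicator_le P (m q) (hm q hq) (fun l => A (q + b * l))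
      (M := M) (p := p) hθ0 hθ1 hα0 (hA q hq) (fun l hl => hA' _ (hidx q hq l hl))
      (fun l hl => hp _ (hidx q hq l hl)) (hα q hq) M le_rfl
    refine h.trans (add_le_add_left ?_ _)
    -- `p ≤ 1` is read off an actual event, which requires a nonempty class.
    rcases Nat.eq_zero_or_pos M with rfl | hM
    · simp
    have hp1 : p ≤ 1 := by
      rw [← hp _ (hidx q hq 0 hM)]; exact measureReal_le_one
    calc (1 - θ * p) ^ M ≤ Real.exp (-(θ * p)) ^ M :=
          pow_le_pow_left₀ (sub_nonneg.2 (mul_le_one₀ hθ1 hp0 hp1)) (Real.one_sub_le_exp_neg _) M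
      _ = Real.exp (-(θ * p * M)) := by rw [← Real.exp_nat_mul]; ring_nf
      _ ≤ _ := Real.exp_le_exp.2 (neg_le_neg (by gcongr))
  set F : Ω → ℝ := fun ω => Real.exp (lam * κ / b) * ((∑ q ∈ Finset.range b, G q ω) / b) with hF
  have hF0 : ∀ ω, 0 ≤ F ω := fun ω =>
    mul_nonneg (Real.exp_pos _).le (div_nonneg (Finset.sum_nonneg fun q _ => hG0 q ω) hb'.le)
  have hGsum : Integrable (fun ω => ∑ q ∈ Finset.range b, G q ω) P :=
    integrable_finsetSum _ fun q hq => hGi q (Finset.mem_range.1 hq)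
  have hFi : Integrable F P := (hGsum.div_const _).const_mul _
  -- On the event the class average dominates `exp (-lam * κ / b)`, so `F ≥ 1` and Markov's
  -- inequality applies.
  have hsub : {ω | ∑ i ∈ Finset.range n, (A i).indicator (fun _ => (1 : ℝ)) ω ≤ κ}
      ⊆ {ω | 1 ≤ F ω} := by
    intro ω (hω : _ ≤ κ)
    have h1 : ∑ q ∈ Finset.range b, ∑ l ∈ Finset.range M,
        (A (q + b * l)).indicator (fun _ => (1 : ℝ)) ω ≤ κ := by
      rw [← sum_range_mul_eq_sum_residues (fun i => (A i).indicator (fun _ => (1 : ℝ)) ω)]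
      refine le_trans (Finset.sum_le_sum_of_subset_of_nonneg ?_ fun i _ _ => ?_) hω
      · exact Finset.range_subset_range.2 hbM
      · exact Set.indicator_nonneg (fun _ _ => zero_le_one) ω
    have h2 := exp_neg_sum_le_average hb lam fun q => ∑ l ∈ Finset.range M,
        (A (q + b * l)).indicator (fun _ => (1 : ℝ)) ω
    simp only [← hGexp] at h2
    have h3 : (1 : ℝ) = Real.exp (lam * κ / b) * Real.exp (-(lam / b) * κ) := by
      rw [← Real.exp_add]; ring_nf; simp
    change 1 ≤ F ω
    rw [h3]
    refine mul_le_mul_of_nonneg_left (le_trans (Real.exp_le_exp.2 ?_) h2) (Real.exp_pos _).le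
    have : 0 ≤ lam / b := by positivity
    nlinarith
  refine (measureReal_mono hsub).trans ?_
  have hmarkov := mul_meas_ge_le_integral_of_nonneg (.of_forall hF0) hFi 1
  rw [one_mul] at hmarkov
  refine hmarkov.trans ?_
  rw [hF, integral_const_mul, integral_div, integral_finsetSum _ fun q hq =>
    hGi q (Finset.mem_range.1 hq)]
  refine mul_le_mul_of_nonneg_left ?_ (Real.exp_pos _).le
  rw [div_le_iff₀ hb']
  calc ∑ q ∈ Finset.range b, ∫ ω, G q ω ∂P
      ≤ ∑ q ∈ Finset.range b, (Real.exp (-(lam / 2 * p * M)) + M * α) :=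
        Finset.sum_le_sum fun q hq => hGint q (Finset.mem_range.1 hq)
    _ = _ := by rw [Finset.sum_const, Finset.card_range, nsmul_eq_mul, mul_comm]

theorem abs_measureReal_inter_sub_le_alphaCoeff {Ω : Type*} [MeasurableSpace Ω] {d : ℕ}
    (P : Measure Ω) [IsProbabilityMeasure P] (X : ℕ → ℕ → Ω → EuclideanSpace ℝ (Fin d))
    {m n k : ℕ} {A B : Set Ω} (hk : 1 ≤ k) (hkn : k + m ≤ n)
    (hA : MeasurableSet[KNN.segmentSigma X n 1 k] A)
    (hB : MeasurableSet[KNN.segmentSigma X n (k + m) n] B) :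
    |P.real (A ∩ B) - P.real A * P.real B| ≤ KNN.alphaCoeff P X m := by
  refine le_csSup ⟨1, ?_⟩ ⟨n, k, A, B, hk, hkn, hA, hB, rfl⟩
  rintro t ⟨n, k, A, B, -, -, -, -, rfl⟩
  have h1 : P.real (A ∩ B) ≤ 1 := measureReal_le_one
  have h2 : P.real A ≤ 1 := measureReal_le_one
  have h3 : P.real B ≤ 1 := measureReal_le_one
  have h4 : 0 ≤ P.real (A ∩ B) := measureReal_nonneg
  have h5 : 0 ≤ P.real A := measureReal_nonneg
  have h6 : 0 ≤ P.real B := measureReal_nonneg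
  rw [abs_le]
  constructor <;> nlinarith

/-- The lower-tail bound for the number of entries of a row that lie in a given set. -/
theorem measureReal_count_le_of_geometricMixing {Ω : Type*} [MeasurableSpace Ω] {d : ℕ}
    (P : Measure Ω) [IsProbabilityMeasure P] (X : ℕ → ℕ → Ω → EuclideanSpace ℝ (Fin d))
    (μ : Measure (EuclideanSpace ℝ (Fin d))) (hX : KNN.IsTriangularArray P X μ) {γ : ℝ}
    (hmix : KNN.GeometricMixing P X γ) {B : Set (EuclideanSpace ℝ (Fin d))} (hB : MeasurableSet B)
    (n b M : ℕ) (hb : 1 ≤ b) (hbM : b * M ≤ n) {lam κ : ℝ} (hl0 : 0 ≤ lam) (hl1 : lam ≤ 1) :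
    P.real {ω | ∑ i ∈ Finset.range n, (X n (i + 1) ⁻¹' B).indicator (fun _ => (1 : ℝ)) ω ≤ κ}
      ≤ Real.exp (lam * κ / b) *
        (Real.exp (-(lam / 2 * μ.real B * M)) + M * Real.exp (-γ * b)) := by
  have hmeas : ∀ i < n, MeasurableSet (X n (i + 1) ⁻¹' B) := fun i hi =>
    hX.measurable n (i + 1) (by omega) (by omega) hB
  have hidx : ∀ q < b, ∀ l < M, q + b * l < n := fun q hq l hl => by
    have : b * (l + 1) ≤ b * M := Nat.mul_le_mul_left b hl
    rw [Nat.mul_succ] at this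
    omega
  have hseg : ∀ a c i : ℕ, a ≤ i → i ≤ c →
      MeasurableSet[KNN.segmentSigma X n a c] (X n i ⁻¹' B) := by
    intro a c i h1 h2
    have hle : MeasurableSpace.comap (X n i) inferInstance ≤ KNN.segmentSigma X n a c :=
      le_iSup₂ (f := fun (i : ℕ) (_ : i ∈ Set.Icc a c) =>
        MeasurableSpace.comap (X n i) inferInstance) i ⟨h1, h2⟩
    exact hle _ ⟨B, hB, rfl⟩
  refine measureReal_count_le P (fun i => X n (i + 1) ⁻¹' B) n b M hb hbM
    -- The past of a class ends at its previous entry, shifted to one-based indices. The cap at `n`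
    -- keeps it inside the row, where measurability is known, for every `l`.
    (fun q l => KNN.segmentSigma X n 1 (min (q + b * (l - 1) + 1) n)) ?_ (Real.exp_pos _).le
    hl0 hl1 ?_ hmeas ?_ measureReal_nonneg ?_
  · intro q _ l
    refine iSup₂_le fun i hi => ?_
    exact (hX.measurable n i hi.1 (hi.2.trans (min_le_right _ _))).comap_le
  · intro q hq l hl i hi
    refine hseg _ _ _ (by omega) (le_min ?_ ?_)
    · have := Nat.mul_le_mul_left b (show i ≤ l - 1 by omega)
      omega
    · have := hidx q hq i (hi.trans hl)
      omega
  · intro i hi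
    rw [← hX.map_eq n (i + 1) (by omega) (by omega),
      map_measureReal_apply (hX.measurable n (i + 1) (by omega) (by omega)) hB]
  · intro q hq l hl hl1 H hH
    obtain ⟨l, rfl⟩ : ∃ l', l = l' + 1 := ⟨l - 1, by omega⟩
    have hn := hidx q hq _ hl
    rw [Nat.mul_succ] at hn
    have hmin : min (q + b * (l + 1 - 1) + 1) n = q + b * l + 1 := by
      rw [Nat.add_sub_cancel]; omega
    change MeasurableSet[KNN.segmentSigma X n 1 (min (q + b * (l + 1 - 1) + 1) n)] H at hH
    rw [hmin] at hH
    have hB' := hseg (q + b * l + 1 + b) n (q + b * (l + 1) + 1) (by rw [Nat.mul_succ]; omega)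
      (by rw [Nat.mul_succ]; omega)
    have h := (abs_measureReal_inter_sub_le_alphaCoeff P X (by omega) (by omega) hH hB').trans
      (hmix b hb)
    linarith [(abs_le.1 h).1]

/-! ### Choice of parameters -/

/-- Optimizing the exponent in the lower-tail bound: `T` is an eighth of the expected number of
occurrences per residue class. -/
theorem exists_exponent {T L : ℝ} (hL : 0 ≤ L) :
    ∃ lam : ℝ, 0 ≤ lam ∧ lam ≤ 1 ∧ lam * T ≤ 7 * L ∧
      Real.exp (-(lam * T)) ≤ Real.exp (-T) + Real.exp (-(7 * L)) := by
  -- The choice makes `lam * T = min T (7 * L)`.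
  by_cases h : T ≤ 7 * L
  · exact ⟨1, zero_le_one, le_rfl, by linarith, by simpa using (Real.exp_pos _).le⟩
  · have hT' : 0 < T := by linarith
    refine ⟨7 * L / T, by positivity, ?_, ?_, ?_⟩
    · rw [div_le_one hT']; linarith
    · rw [div_mul_cancel₀ _ hT'.ne']
    · rw [div_mul_cancel₀ _ hT'.ne']; linarith [Real.exp_pos (-T)]

theorem theorem2 (γ : ℝ) (hγ : 0 < γ) :
    ∃ (c₀ C : ℝ) (N : ℕ), 0 < c₀ ∧ 0 < C ∧
      ∀ (d : ℕ), 1 ≤ d →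
      ∀ (Ω : Type*) [MeasurableSpace Ω] (P : Measure Ω) [IsProbabilityMeasure P]
        (X : ℕ → ℕ → Ω → EuclideanSpace ℝ (Fin d))
        (μ : Measure (EuclideanSpace ℝ (Fin d))) [IsProbabilityMeasure μ]
        (x : EuclideanSpace ℝ (Fin d)) (cm r₀ s D : ℝ),
        KNN.IsTriangularArray P X μ →
        KNN.GeometricMixing P X γ →
        0 < cm → 0 < r₀ → 0 < s → KNN.LocalLowerMass μ x cm r₀ s →
        KNN.SupportInCompact μ D →
        ∀ n : ℕ, N ≤ n → ∀ (k : ℕ) (hk : 1 ≤ k ∧ k ≤ n) (j : ℕ),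
          2 ^ j * KNN.rStar cm s n k ≤ r₀ →
          P.real {ω | 2 ^ j * KNN.rStar cm s n k < KNN.nnRadius X x n k hk ω} ≤
            4 * Real.exp (-c₀ * (2 : ℝ) ^ ((j : ℝ) * s) * ((k : ℝ) / Real.log n)) +
              C * (n : ℝ) ^ (-7 : ℤ) := by
  -- `15 = 7 + 1 + 7`: the Chernoff factor, the number of entries in a class, and the target rate `n
  -- ^ (-7)`.
  set a : ℝ := 15 / γ with ha
  have ha0 : 0 < a := by positivity
  obtain ⟨N₀, hN₀⟩ : ∃ N₀ : ℕ, ∀ n : ℕ, N₀ ≤ n → (a + 1) * Real.log n ≤ n := by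
    have h := (Real.isLittleO_log_id_atTop.comp_tendsto tendsto_natCast_atTop_atTop).bound
      (show (0 : ℝ) < 1 / (a + 1) by positivity)
    obtain ⟨N₀, hN₀⟩ := Filter.eventually_atTop.1 h
    refine ⟨N₀, fun n hn => ?_⟩
    have h1 := hN₀ n hn
    simp only [Function.comp_apply, id_eq, Real.norm_eq_abs, Nat.abs_cast] at h1
    have h2 := (le_abs_self _).trans h1
    rw [one_div, inv_mul_eq_div, le_div_iff₀ (by positivity)] at h2
    linarith
  refine ⟨1 / (a + 1), 2, max N₀ 3, by positivity, two_pos, ?_⟩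
  intro d _ Ω _ P _ X μ _ x cm r₀ s D hX hmix hcm hr₀ hs hmass _ n hn k hk j hj
  have hn3 : 3 ≤ n := (le_max_right _ _).trans hn
  have hnR : (0 : ℝ) < n := by exact_mod_cast (show 0 < n by omega)
  have hkR : (0 : ℝ) < k := by exact_mod_cast hk.1
  set L := Real.log n with hL
  have hL1 : 1 ≤ L := by
    rw [hL, Real.le_log_iff_exp_le hnR]
    exact Real.exp_one_lt_three.le.trans (by exact_mod_cast hn3)
  set b := ⌈a * L⌉₊ with hb
  have hb1 : 1 ≤ b := Nat.ceil_pos.2 (by positivity)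
  have hbR : (0 : ℝ) < b := by exact_mod_cast hb1
  have hbL : a * L ≤ b := Nat.le_ceil _
  have hbU : (b : ℝ) ≤ (a + 1) * L := by
    have := (Nat.ceil_lt_add_one (show 0 ≤ a * L by positivity)).le
    linarith
  have hbn : b ≤ n := by exact_mod_cast hbU.trans (hN₀ n ((le_max_left _ _).trans hn))
  set M := n / b with hM
  have hbM : b * M ≤ n := Nat.mul_div_le n b
  have hMn : (M : ℝ) ≤ n := by exact_mod_cast Nat.div_le_self n b
  -- As `b ≤ n`, rounding down in `n / b` loses at most a factor two.
  have hM2 : (n : ℝ) ≤ 2 * b * M := by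
    have h1 : 1 ≤ M := (Nat.one_le_div_iff hb1).2 hbn
    have h2 : n < b * (M + 1) := Nat.lt_mul_div_succ n hb1
    have h3 : b * 1 ≤ b * M := Nat.mul_le_mul_left b h1
    have h4 : n ≤ 2 * (b * M) := by rw [Nat.mul_succ] at h2; omega
    calc (n : ℝ) ≤ ((2 * (b * M) : ℕ) : ℝ) := by exact_mod_cast h4
      _ = _ := by push_cast; ring
  set r := 2 ^ j * KNN.rStar cm s n k with hr
  have hr0 : 0 < r := by unfold r KNN.rStar; positivity
  set p := μ.real (Metric.closedBall x r) with hp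
  set J : ℝ := (2 : ℝ) ^ ((j : ℝ) * s) with hJ
  have hJ1 : 1 ≤ J := Real.one_le_rpow one_le_two (by positivity)
  have hpn : 8 * k * J ≤ n * p := by
    have h := hmass r hr0 hj
    have hrs : r ^ s = J * (8 * k / (cm * n)) := by
      rw [hr, Real.mul_rpow (by positivity) (by unfold KNN.rStar; positivity), KNN.rStar,
        ← Real.rpow_mul (by positivity), one_div_mul_cancel hs.ne', Real.rpow_one, hJ,
        Real.rpow_mul two_pos.le, Real.rpow_natCast]
    rw [hrs] at h
    have h2 := mul_le_mul_of_nonneg_left h hnR.le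
    calc 8 * k * J = n * (cm * (J * (8 * k / (cm * n)))) := by field_simp
      _ ≤ n * p := h2
  have hp0 : 0 ≤ p := measureReal_nonneg
  set T := n * p / (8 * b) with hT
  obtain ⟨lam, hl0, hl1, hlT, hexp⟩ := exists_exponent (T := T) (zero_le_one.trans hL1)
  have hsub : {ω | r < KNN.nnRadius X x n k hk ω} ⊆ {ω | ∑ i ∈ Finset.range n,
      (X n (i + 1) ⁻¹' Metric.closedBall x r).indicator (fun _ => (1 : ℝ)) ω ≤ (k : ℝ)} :=
    fun ω hω => card_le_of_lt_nnRadius X x n k hk ω r hω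
  refine (measureReal_mono hsub).trans <| (measureReal_count_le_of_geometricMixing P X μ hX hmix
    measurableSet_closedBall n b M hb1 hbM hl0 hl1).trans ?_
  have hn7 : (n : ℝ) ^ (-7 : ℤ) = Real.exp (-(7 * L)) := by
    rw [show -(7 * L) = L * ((-7 : ℤ) : ℝ) by push_cast; ring, hL, Real.exp_mul,
      Real.exp_log hnR, Real.rpow_intCast]
  have hkT : lam * k / b ≤ lam * T := by
    rw [mul_div_assoc]
    refine mul_le_mul_of_nonneg_left ?_ hl0
    rw [hT, div_le_div_iff₀ hbR (by positivity)]
    nlinarith [mul_le_mul_of_nonneg_left hJ1 hkR.le]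
  -- Of these two copies of `lam * T`, one absorbs the Chernoff factor and the other gives the
  -- decay.
  have hMT : 2 * (lam * T) ≤ lam / 2 * p * M := by
    have h1 : 2 * T ≤ p * M / 2 := by
      rw [hT, ← mul_div_assoc, div_le_iff₀ (by positivity)]
      nlinarith [mul_le_mul_of_nonneg_right hM2 hp0]
    nlinarith [mul_le_mul_of_nonneg_left h1 hl0]
  have hmain : Real.exp (lam * k / b) * Real.exp (-(lam / 2 * p * M)) ≤ Real.exp (-(lam * T)) := by
    rw [← Real.exp_add]
    exact Real.exp_le_exp.2 (by linarith)
  have herr : Real.exp (lam * k / b) * (M * Real.exp (-γ * b)) ≤ Real.exp (-(7 * L)) := by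
    have hMe : (M : ℝ) ≤ Real.exp L := by rw [hL, Real.exp_log hnR]; exact hMn
    have hγb : 15 * L ≤ γ * b := by
      have := mul_le_mul_of_nonneg_left hbL hγ.le
      rwa [ha, ← mul_assoc, mul_div_cancel₀ _ hγ.ne'] at this
    calc Real.exp (lam * k / b) * (M * Real.exp (-γ * b))
        ≤ Real.exp (lam * k / b) * (Real.exp L * Real.exp (-γ * b)) := by gcongr
      _ = Real.exp (lam * k / b + (L + -γ * b)) := by rw [Real.exp_add, Real.exp_add]
      _ ≤ _ := Real.exp_le_exp.2 (by linarith)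
  have hfin : Real.exp (-T) ≤ Real.exp (-(1 / (a + 1)) * J * (k / L)) := by
    refine Real.exp_le_exp.2 ?_
    have h1 : 1 / (a + 1) * J * (k / L) = J * k / ((a + 1) * L) := by
      field_simp
    have h2 : J * k / ((a + 1) * L) ≤ J * k / b :=
      div_le_div_of_nonneg_left (by positivity) hbR hbU
    have h3 : J * k / b ≤ T := by
      rw [hT, div_le_div_iff₀ hbR (by positivity)]
      nlinarith
    linarith
  rw [hn7, mul_add]
  linarith [Real.exp_pos (-(1 / (a + 1)) * J * (k / L))]
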